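/- **Model.** Fix a non-empty alphabet $\Sigma$. A *glue* is a pair (label in $\Sigma^*$, strength in $\mathbb N$), with exactly one glue of strength $0$; a *tile type* assigns a glue to each of the four sides of a unit square (tiles are not rotated). Given a finite set $T$ of tile types, a *configuration* is a partial function $\alpha:\mathbb Z^2\dashrightarrow T$; two adjacent tiles bind with strength $s$ if their abutting glues are equal and have strength $s>0$. An *assembly* is a configuration with non-empty connected domain; it is *$\tau$-stable* if every cut of its binding graph has total weight at least $\tau$. A *tile-assembly system* (aTAM system) is a triple $\mathcal T=(T,\sigma,\tau)$ with $\tau\in\mathbb Z^+$ (the temperature) and $\sigma$ (the seed) a finite $\tau$-stable assembly of tiles from $T$. An assembly is *producible* if it is the result of a finite or infinite sequence of $\tau$-stable assemblies that starts with $\sigma$ and in which each assembly extends the previous one by exactly one tile (the result of an infinite sequence is the union of its assemblies), and *terminal* if it is $\tau$-stable and no tile can be added to it so that the result is $\tau$-stable. Each tile type of $T$ is coloured black or white. For $i,j<n$ let $\mathrm{SinglePixel}(n,i,j)$ be the pattern on the square $\{0,\dots,n-1\}^2$ that is black at $(i,j)$ and white everywhere else. The system *weakly self-assembles* this pattern if,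 in every producible terminal assembly, the set of locations of the tiles coloured black or white is exactly $\{0,\dots,n-1\}^2$ and the colour of the tile at each of these locations is the one prescribed by the pattern. **Theorem.** There is a function $f:\mathbb N\to\mathbb R$ with $f(n)=O(\log n)$ as $n\to\infty$ such that for all $n,i,j\in\mathbb N$ with $i,j<n$ there exist an aTAM system $\mathcal T=(T,\sigma,2)$ of temperature $2$ with $|\sigma|=1$ and $|T|\le f(n)$, and a colouring of its tile types by black and white, such that $\mathcal T$ weakly self-assembles $\mathrm{SinglePixel}(n,i,j)$. -/

import Mathlib

namespace ATAM

/-- Locations of the two-dimensional lattice. -/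
abbrev Pos := ℤ × ℤ

/-- The four sides of a unit square tile. -/
inductive Dir
  | north | east | south | west

/-- The unit vector pointing out of a side. -/
def Dir.vec : Dir → Pos
  | .north => (0, 1)
  | .east => (1, 0)
  | .south => (0, -1)
  | .west => (-1, 0)

/-- The opposite side. -/
def Dir.opp : Dir → Dir
  | .north => .south
  | .east => .west
  | .south => .north
  | .west => .east

/-- A glue: a finite string over the alphabet `A` together with a strength in `ℕ`.
There is only one glue of strength `0`, the null glue. -/
structure Glue (A : Type*) where
  label : List A
  strength : ℕ
  label_eq_nil_of_null : strength = 0 → label = []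

/-- A tile type: a glue on each of the four sides (tiles do not rotate). -/
abbrev TileType (A : Type*) := Dir → Glue A

/-- A configuration: a partial function from locations to tile types. -/
abbrev Config (A : Type*) := Pos → Option (TileType A)

namespace Config

variable {A : Type*}

/-- The locations that hold a tile. -/
def dom (α : Config A) : Set Pos := {p | ∃ t, α p = some t}

/-- All tiles of the configuration are of types in `T`. -/
def Over (α : Config A) (T : Finset (TileType A)) : Prop :=
  ∀ p t, α p = some t → t ∈ T

open Classical in
/-- The strength with which the tiles at `p` and at its neighbour in direction `d` interact;
it is `0` if one of the two locations is empty or the abutting glues differ. -/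
noncomputable def bond (α : Config A) (p : Pos) (d : Dir) : ℕ :=
  match α p, α (p + d.vec) with
  | some t, some u => if t d = u d.opp then (t d).strength else 0
  | _, _ => 0

open Classical in
/-- The weight of the cut of the binding graph that separates `X` from its complement: the total
strength of all bonds leaving `X`, as a supremum of finite sums. -/
noncomputable def cutWeight (α : Config A) (X : Set Pos) : ℕ∞ :=
  ⨆ F : Finset (Pos × Dir),
    ((∑ e ∈ F, if e.1 ∈ X ∧ e.1 + e.2.vec ∉ X then α.bond e.1 e.2 else 0 : ℕ) : ℕ∞)

/-- Every cut of the binding graph has weight at least `τ`. -/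
def Stable (τ : ℕ) (α : Config A) : Prop :=
  ∀ X : Set Pos, X ⊆ α.dom → X.Nonempty → (α.dom \ X).Nonempty → (τ : ℕ∞) ≤ α.cutWeight X

/-- `α` is a subassembly of `β`. -/
def Sub (α β : Config A) : Prop := ∀ p t, α p = some t → β p = some t

end Config

/-- The lattice `ℤ × ℤ` as a graph, with edges between locations at distance one. -/
def gridGraph : SimpleGraph Pos := SimpleGraph.fromRel fun p q => ∃ d : Dir, q = p + d.vec

/-- An assembly: a configuration whose domain is non-empty and connected. -/
def Config.IsAssembly {A : Type*} (α : Config A) : Prop :=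
  (gridGraph.induce α.dom).Connected

/-- A tile-assembly system `(T, σ, τ)`. -/
structure TAS (A : Type*) where
  tiles : Finset (TileType A)
  seed : Config A
  temp : ℕ
  temp_pos : 0 < temp
  seed_over : seed.Over tiles
  seed_isAssembly : seed.IsAssembly
  seed_finite : seed.dom.Finite
  seed_stable : seed.Stable temp

namespace TAS

variable {A : Type*}

/-- `α` produces `β` in one step: both are `τ`-stable assemblies of tiles from `T`, and `β`
arises from `α` by the addition of a single tile. -/
def Step (𝒯 : TAS A) (α β : Config A) : Prop :=
  (α.Over 𝒯.tiles ∧ α.IsAssembly ∧ α.Stable 𝒯.temp) ∧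
  (β.Over 𝒯.tiles ∧ β.IsAssembly ∧ β.Stable 𝒯.temp) ∧
  α.Sub β ∧ (β.dom \ α.dom).ncard = 1

/-- `β` is the result of a finite or of an infinite assembly sequence that starts with `α`. The
result of an infinite sequence consists of all tiles of all its assemblies. -/
def Produces (𝒯 : TAS A) (α β : Config A) : Prop :=
  Relation.ReflTransGen 𝒯.Step α β ∨
  ∃ s : ℕ → Config A, s 0 = α ∧ (∀ k, 𝒯.Step (s k) (s (k + 1))) ∧
    ∀ p t, β p = some t ↔ ∃ k, s k p = some t

/-- `α` is producible from the seed. -/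
def Producible (𝒯 : TAS A) (α : Config A) : Prop := 𝒯.Produces 𝒯.seed α

/-- `α` is stable and no tile can be added to it. -/
def Terminal (𝒯 : TAS A) (α : Config A) : Prop :=
  α.Stable 𝒯.temp ∧ ¬ ∃ β, 𝒯.Step α β

/-- The system, with tile types coloured by `color`, weakly self-assembles the pattern `P`: in every
producible terminal assembly, the locations of the tiles with colours in `CP` are exactly the
locations of `P`, and they have the colours that `P` prescribes. -/
def WeaklySelfAssembles {C : Type*} (𝒯 : TAS A) (color : TileType A → C) (CP : Set C)
    (P : Set (Pos × C)) : Prop :=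
  ∀ α, 𝒯.Producible α → 𝒯.Terminal α →
    {p | ∃ t, α p = some t ∧ color t ∈ CP} = Prod.fst '' P ∧
    ∀ p c, (p, c) ∈ P → ∃ t, α p = some t ∧ color t = c

end TAS

/-- The two colours of pixels. -/
inductive Color
  | white | black

/-- The `n × n` square `{0, …, n-1} × {0, …, n-1}`, white except for a black pixel at `(i, j)`. -/
def singlePixel (n i j : ℕ) : Set (Pos × Color) :=
  {x | (0 ≤ x.1.1 ∧ x.1.1 < n) ∧ (0 ≤ x.1.2 ∧ x.1.2 < n) ∧
    x.2 = if x.1 = ((i : ℤ), (j : ℤ)) then Color.black else Color.white}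

end ATAM

/-!
The `n × n` square is cut into `k = ⌈log₂ n⌉` rows that hold a binary counter and a body above
them. The counter writes the binary expansion of `n - x` into column `x`, using a constant number of
tile types per row; comparing digits on the way, it marks the columns in which the pixel lies and in
which the diagonal of the body starts, and also the column whose number is the row of the pixel.
The marks travel upwards through the body. On the diagonal, the last mark is turned by a right angle
and runs along the row of the pixel, so that a constant number of tile types suffices for the body
and the pixel is recognized where its row meets its column. If the pixel lies in the rows of the
counter, the reflected construction is used; this requires `2 * k ≤ n`, and for the remaining small
`n` every location gets a tile type of its own.

All these systems have temperature `2` and are locally deterministic: every tile attaches with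
inputs of total strength exactly `2`, and these inputs determine the tile. Hence every producible
assembly is a part of the intended one, and a terminal one is all of it.
-/

namespace ATAM

namespace Dir

instance : DecidableEq Dir := fun a b => by
  cases a <;> cases b <;> first | exact isTrue rfl | exact isFalse Dir.noConfusion

instance : Fintype Dir :=
  ⟨{.north, .east, .south, .west}, by rintro ⟨⟩ <;> simp⟩

theorem opp_opp (d : Dir) : d.opp.opp = d := by cases d <;> rfl

theorem opp_injective : Function.Injective opp := fun a b h => by
  rw [← opp_opp a, h, opp_opp]

theorem vec_opp (d : Dir) : d.opp.vec = -d.vec := by cases d <;> rfl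

theorem vec_ne_zero (d : Dir) : d.vec ≠ 0 := by cases d <;> decide

theorem vec_injective : Function.Injective vec := fun a b h => by
  revert h
  cases a <;> cases b <;> decide

theorem add_vec_add_vec_opp (p : Pos) (d : Dir) : p + d.vec + d.opp.vec = p := by
  rw [vec_opp, add_neg_cancel_right]

theorem add_vec_ne (p : Pos) (d : Dir) : p + d.vec ≠ p := by simpa using d.vec_ne_zero

end Dir

theorem gridGraph_adj_add_vec (p : Pos) (d : Dir) : gridGraph.Adj p (p + d.vec) := by
  rw [gridGraph, SimpleGraph.fromRel_adj]
  exact ⟨(Dir.add_vec_ne p d).symm, Or.inl ⟨d, rfl⟩⟩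

namespace Config

open Function (update)

variable {A : Type*} {α β : Config A} {p q : Pos} {d : Dir} {t u : TileType A} {X : Set Pos}
  {τ : ℕ}

theorem bond_of_eq (hp : α p = some t) (hq : α (p + d.vec) = some u) (h : t d = u d.opp) :
    α.bond p d = (t d).strength := by
  simp [bond, hp, hq, h]

theorem exists_of_bond_pos (h : 0 < α.bond p d) :
    ∃ t u, α p = some t ∧ α (p + d.vec) = some u ∧ t d = u d.opp ∧
      α.bond p d = (t d).strength := by
  unfold bond at h ⊢
  rcases hp : α p with _ | t
  · simp [hp] at h
  rcases hq : α (p + d.vec) with _ | u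
  · simp [hp, hq] at h
  by_cases e : t d = u d.opp
  · exact ⟨t, u, rfl, rfl, e, by simp [e]⟩
  · simp [hp, hq, e] at h

theorem bond_opp (α : Config A) (p : Pos) (d : Dir) :
    α.bond (p + d.vec) d.opp = α.bond p d := by
  unfold bond
  rw [Dir.add_vec_add_vec_opp]
  rcases α p with _ | t <;> rcases α (p + d.vec) with _ | u <;> try rfl
  by_cases e : t d = u d.opp
  · simp [Dir.opp_opp, e]
  · simp [Dir.opp_opp, e, Ne.symm e]

theorem bond_mono (h : α.Sub β) (p : Pos) (d : Dir) : α.bond p d ≤ β.bond p d := by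
  rcases Nat.eq_zero_or_pos (α.bond p d) with h0 | h0
  · exact h0 ▸ Nat.zero_le _
  · obtain ⟨t, u, hp, hq, e, hb⟩ := exists_of_bond_pos h0
    rw [hb, bond_of_eq (h _ _ hp) (h _ _ hq) e]

theorem Sub.dom_subset (h : α.Sub β) : α.dom ⊆ β.dom := fun _ ⟨t, ht⟩ => ⟨t, h _ t ht⟩

section CutWeight

open Classical in
theorem sum_le_cutWeight (α : Config A) (X : Set Pos) (F : Finset (Pos × Dir)) :
    ((∑ e ∈ F, if e.1 ∈ X ∧ e.1 + e.2.vec ∉ X then α.bond e.1 e.2 else 0 : ℕ) : ℕ∞) ≤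
      α.cutWeight X :=
  le_iSup (fun F : Finset (Pos × Dir) =>
    ((∑ e ∈ F, if e.1 ∈ X ∧ e.1 + e.2.vec ∉ X then α.bond e.1 e.2 else 0 : ℕ) : ℕ∞)) F

theorem cutWeight_singleton (α : Config A) (p : Pos) :
    α.cutWeight {p} = ((∑ d, α.bond p d : ℕ) : ℕ∞) := by
  classical
  have hinj : Set.InjOn (Prod.mk p : Dir → Pos × Dir) (Finset.univ : Finset Dir) :=
    (Prod.mk_right_injective p).injOn
  refine le_antisymm (iSup_le fun F => Nat.cast_le.2 ?_) ?_
  · refine (Finset.sum_le_sum (g := fun e => if e.1 = p then α.bond e.1 e.2 else 0)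
      fun e _ => ?_).trans ?_
    · split_ifs with h h' <;> first | exact absurd h.1 h' | simp
    calc ∑ e ∈ F, (if e.1 = p then α.bond e.1 e.2 else 0)
        = ∑ e ∈ F with e.1 = p, α.bond e.1 e.2 := (Finset.sum_filter _ _).symm
      _ ≤ ∑ e ∈ Finset.univ.image (Prod.mk p), α.bond e.1 e.2 := by
          refine Finset.sum_le_sum_of_subset fun e he => Finset.mem_image.2 ?_
          exact ⟨e.2, Finset.mem_univ _, Prod.ext (Finset.mem_filter.1 he).2.symm rfl⟩
      _ = ∑ d, α.bond p d := Finset.sum_image hinj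
  · refine le_trans (Nat.cast_le.2 (le_of_eq ?_))
      (sum_le_cutWeight α {p} (Finset.univ.image (Prod.mk p)))
    rw [Finset.sum_image hinj]
    exact Finset.sum_congr rfl fun d _ => (if_pos ⟨rfl, Dir.add_vec_ne p d⟩).symm

theorem sum_bond_le_cutWeight_of_notMem (α : Config A) (hp : p ∉ X)
    (hX : ∀ d, 0 < α.bond p d → p + d.vec ∈ X) :
    ((∑ d, α.bond p d : ℕ) : ℕ∞) ≤ α.cutWeight X := by
  classical
  refine le_trans (Nat.cast_le.2 ?_)
    (sum_le_cutWeight α X (Finset.univ.image fun d : Dir => (p + d.vec, d.opp)))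
  rw [Finset.sum_image fun a _ b _ h => Dir.opp_injective (Prod.ext_iff.1 h).2]
  refine Finset.sum_le_sum fun d _ => ?_
  rw [Dir.add_vec_add_vec_opp, bond_opp]
  rcases Nat.eq_zero_or_pos (α.bond p d) with h0 | h0
  · simp [h0]
  · rw [if_pos ⟨hX d h0, hp⟩]

theorem cutWeight_sdiff_singleton_le (h : α.Sub β) (hp : p ∉ α.dom) (X : Set Pos) :
    α.cutWeight (X \ {p}) ≤ β.cutWeight X := by
  classical
  refine iSup_le fun F => le_trans (Nat.cast_le.2 (Finset.sum_le_sum fun e _ => ?_))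
    (sum_le_cutWeight β X F)
  rcases Nat.eq_zero_or_pos (α.bond e.1 e.2) with h0 | h0
  · simp [h0]
  · obtain ⟨t, u, -, hu, -, -⟩ := exists_of_bond_pos h0
    have hne : e.1 + e.2.vec ≠ p := fun he => hp ⟨u, he ▸ hu⟩
    split_ifs with h1 h2
    · exact bond_mono h _ _
    · exact absurd ⟨h1.1.1, fun he => h1.2 ⟨he, hne⟩⟩ h2
    · exact Nat.zero_le _
    · exact le_rfl

end CutWeight

section Update

theorem dom_update (α : Config A) (p : Pos) (t : TileType A) :
    dom (update α p (some t)) = insert p α.dom := by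
  ext q
  rcases eq_or_ne q p with rfl | hq
  · simp [dom]
  · simp [dom, hq]

theorem sub_update (hp : p ∉ α.dom) (t : TileType A) : α.Sub (update α p (some t)) := by
  intro q u hq
  rwa [Function.update_of_ne]
  rintro rfl
  exact hp ⟨u, hq⟩

theorem Sub.eq_update (h : α.Sub β) (hp : β p = some t) (hdom : β.dom = insert p α.dom) :
    β = update α p (some t) := by
  funext q
  rcases eq_or_ne q p with rfl | hq
  · rw [hp, Function.update_self]
  rw [Function.update_of_ne hq]
  rcases hα : α q with _ | u
  · have hβ : q ∉ β.dom := by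
      rw [hdom, Set.mem_insert_iff, or_iff_right hq]
      rintro ⟨u, hu⟩
      simp [hα] at hu
    exact Option.eq_none_iff_forall_ne_some.2 fun u hu => hβ ⟨u, hu⟩
  · exact h _ _ hα

theorem Over.update {T : Finset (TileType A)} (hα : α.Over T) (ht : t ∈ T) :
    Over (update α p (some t)) T := by
  intro q u hq
  rcases eq_or_ne q p with rfl | hqp
  · rw [Function.update_self] at hq
    exact Option.some.inj hq ▸ ht
  · rw [Function.update_of_ne hqp] at hq
    exact hα q u hq

theorem IsAssembly.update (hα : α.IsAssembly) (hd : p + d.vec ∈ α.dom) :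
    IsAssembly (update α p (some t)) := by
  unfold IsAssembly at *
  have h : dom (Function.update α p (some t)) = {p, p + d.vec} ∪ α.dom := by
    rw [dom_update, Set.insert_union, Set.singleton_union, Set.insert_eq_of_mem hd]
  rw [h]
  exact SimpleGraph.induce_union_connected
    (SimpleGraph.induce_pair_connected_of_adj (gridGraph_adj_add_vec p d)).preconnected
    hα.preconnected ⟨p + d.vec, by simp, hd⟩

theorem Stable.update (hα : α.Stable τ) (hp : p ∉ α.dom)
    (hb : τ ≤ ∑ d, bond (update α p (some t)) p d) : Stable τ (update α p (some t)) := by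
  intro X hX hne hco
  rw [dom_update] at hX hco
  by_cases hXp : X ⊆ {p}
  · rw [(Set.subset_singleton_iff_eq.1 hXp).resolve_left hne.ne_empty, cutWeight_singleton]
    exact Nat.cast_le.2 hb
  by_cases hαX : α.dom ⊆ X
  · have hpX : p ∉ X := by
      obtain ⟨q, rfl | hq, hqX⟩ := hco
      · exact hqX
      · exact absurd (hαX hq) hqX
    refine (Nat.cast_le.2 hb).trans (sum_bond_le_cutWeight_of_notMem _ hpX fun d hd => ?_)
    obtain ⟨-, u, -, hu, -, -⟩ := exists_of_bond_pos hd
    have hmem : p + d.vec ∈ dom (Function.update α p (some t)) := ⟨u, hu⟩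
    rw [dom_update] at hmem
    exact hαX (hmem.resolve_left (Dir.add_vec_ne p d))
  · obtain ⟨q, hq, hqX⟩ := Set.not_subset.1 hαX
    refine (hα (X \ {p}) ?_ (Set.sdiff_nonempty.2 hXp) ⟨q, hq, fun h => hqX h.1⟩).trans
      (cutWeight_sdiff_singleton_le (sub_update hp t) hp X)
    exact fun r hr => (hX hr.1).resolve_left hr.2

end Update

section Single

open Classical in
/-- The configuration that consists of a single tile. -/
noncomputable def single (p : Pos) (t : TileType A) : Config A := fun q =>
  if q = p then some t else none

theorem single_eq_some : single p t q = some u ↔ q = p ∧ t = u := by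
  unfold single
  split_ifs with h <;> simp [h]

theorem dom_single (p : Pos) (t : TileType A) : (single p t).dom = {p} := by
  ext q
  simp [dom, single_eq_some]

theorem isAssembly_single (p : Pos) (t : TileType A) : (single p t).IsAssembly := by
  unfold IsAssembly
  rw [dom_single]
  exact { preconnected := fun a b => by rw [Subsingleton.elim a b], nonempty := ⟨p, rfl⟩ }

theorem stable_single (τ : ℕ) (p : Pos) (t : TileType A) : (single p t).Stable τ := by
  rw [Stable, dom_single]
  rintro X hX ⟨q, hq⟩ ⟨r, hr, hrX⟩
  obtain rfl : q = p := hX hq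
  obtain rfl : r = q := hr
  exact absurd hq hrX

end Single

end Config

namespace TAS

open Function (update)

variable {A : Type*} {𝒯 : TAS A} {α β : Config A} {p : Pos} {t : TileType A}

theorem step_update (hover : α.Over 𝒯.tiles) (hconn : α.IsAssembly) (hst : α.Stable 𝒯.temp)
    (hp : p ∉ α.dom) (ht : t ∈ 𝒯.tiles)
    (hb : 𝒯.temp ≤ ∑ d, Config.bond (update α p (some t)) p d) :
    𝒯.Step α (update α p (some t)) := by
  obtain ⟨d, -, hd⟩ := Finset.exists_ne_zero_of_sum_ne_zero (𝒯.temp_pos.trans_le hb).ne'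
  obtain ⟨-, u, -, hu, -, -⟩ := Config.exists_of_bond_pos (Nat.pos_of_ne_zero hd)
  rw [Function.update_of_ne (Dir.add_vec_ne p d)] at hu
  refine ⟨⟨hover, hconn, hst⟩, ⟨hover.update ht, hconn.update ⟨u, hu⟩, hst.update hp hb⟩,
    Config.sub_update hp t, Set.ncard_eq_one.2 ⟨p, ?_⟩⟩
  rw [Config.dom_update, Set.insert_sdiff_of_notMem _ hp, Set.sdiff_self]
  exact insert_empty_eq p

theorem Step.exists_eq_update (h : 𝒯.Step α β) :
    ∃ p, ∃ t ∈ 𝒯.tiles, p ∉ α.dom ∧ β = update α p (some t) ∧ 𝒯.temp ≤ ∑ d, β.bond p d := by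
  obtain ⟨⟨-, hconn, -⟩, ⟨hover, -, hst⟩, hsub, hcard⟩ := h
  obtain ⟨p, hp⟩ := Set.ncard_eq_one.1 hcard
  obtain ⟨⟨t, ht⟩, hpα⟩ : p ∈ β.dom \ α.dom := hp ▸ rfl
  have hdom : β.dom = insert p α.dom := by
    rw [Set.insert_eq, ← hp, Set.sdiff_union_of_subset hsub.dom_subset]
  refine ⟨p, t, hover p t ht, hpα, hsub.eq_update ht hdom, ?_⟩
  obtain ⟨q, hq⟩ : α.dom.Nonempty := Set.nonempty_coe_sort.1 hconn.nonempty
  have hcut := hst {p} (Set.singleton_subset_iff.2 ⟨t, ht⟩) (Set.singleton_nonempty p)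
    ⟨q, hsub.dom_subset hq, fun h => hpα (h ▸ hq)⟩
  rw [Config.cutWeight_singleton] at hcut
  exact Nat.cast_le.1 hcut

theorem Step.ncard_dom_lt (h : 𝒯.Step α β) (hβ : β.dom.Finite) : α.dom.ncard < β.dom.ncard := by
  obtain ⟨p, t, -, hp, rfl, -⟩ := h.exists_eq_update
  rw [Config.dom_update] at hβ ⊢
  exact Set.ncard_lt_ncard (Set.ssubset_insert hp) hβ

end TAS

/-! ### Locally deterministic assemblies -/

/-- A labelling of the sides of all unit squares that agrees on abutting sides. Labels are the
abstract versions of glues: besides a strength, a label has a flow direction, the direction in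
which information crosses its side during the assembly. -/
structure Labeling (L : Type*) where
  label : Pos → Dir → L
  strength : L → ℕ
  flow : L → Dir
  label_opp : ∀ p d, label (p + d.vec) d.opp = label p d

/-- The strength with which information enters the square at `p` through its side `d`; it is `0`
if the flow leaves the square there. -/
def Labeling.input {L : Type*} (F : Labeling L) (p : Pos) (d : Dir) : ℕ :=
  if F.flow (F.label p d) = d.opp then F.strength (F.label p d) else 0

/-- A blueprint of a temperature-`2` assembly, in the spirit of the locally deterministic systems of
Soloveichik and Winfree: every square of `cells` other than the seed has inputs of total strength
exactly `2`, coming from squares of smaller rank, and by `determined` a tile that fits the inputs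
at a location is the intended one for this location. -/
structure Blueprint (L R : Type*) [LinearOrder R] extends Labeling L where
  cells : Finset Pos
  seed : Pos
  rank : Pos → R
  seed_mem : seed ∈ cells
  flow_axis : ∀ p ∈ cells, ∀ d, 0 < strength (label p d) →
    flow (label p d) = d ∨ flow (label p d) = d.opp
  input_seed : ∀ d, toLabeling.input seed d = 0
  sum_input : ∀ p ∈ cells, p ≠ seed → ∑ d, toLabeling.input p d = 2
  input_mem : ∀ p ∈ cells, ∀ d, 0 < toLabeling.input p d →
    p + d.vec ∈ cells ∧ rank (p + d.vec) < rank p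
  determined : ∀ q ∈ cells, q ≠ seed → ∀ p,
    (∀ d, 0 < toLabeling.input q d → p + d.vec ∈ cells ∧ label p d = label q d) →
    p ∈ cells ∧ label p = label q

theorem Labeling.input_of_flow {L : Type*} (F : Labeling L) {p : Pos} {d : Dir}
    (h : F.flow (F.label p d) = d.opp) : F.input p d = F.strength (F.label p d) := if_pos h

theorem Labeling.flow_of_input_pos {L : Type*} {F : Labeling L} {p : Pos} {d : Dir}
    (h : 0 < F.input p d) : F.flow (F.label p d) = d.opp := by
  by_contra hne
  simp [input, hne] at h

namespace Blueprint

open Function (update)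

variable {A L R : Type*} [LinearOrder R] (B : Blueprint L R)

section System

variable [Countable L]

/-- The glue that implements the label `l`: a power of the letter `a` whose length encodes `l`. -/
noncomputable def glue (a : A) (l : L) : Glue A where
  label := if B.strength l = 0 then [] else
    List.replicate ((exists_injective_nat L).choose l) a
  strength := B.strength l
  label_eq_nil_of_null h := if_pos h

theorem eq_of_glue_eq {a : A} {l m : L} (hl : 0 < B.strength l) (h : B.glue a l = B.glue a m) :
    l = m := by
  have hstr : B.strength l = B.strength m := congrArg Glue.strength h
  have hlab := congrArg Glue.label h
  simp only [glue, if_neg hl.ne', if_neg (hstr ▸ hl.ne')] at hlab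
  exact (exists_injective_nat L).choose_spec (List.replicate_left_injective a hlab)

/-- The tile type that the blueprint intends for the location `p`. -/
noncomputable def tile (a : A) (p : Pos) : TileType A := fun d => B.glue a (B.label p d)

open Classical in
/-- The temperature-`2` tile-assembly system with the tile types of a blueprint. -/
noncomputable def system (a : A) : TAS A where
  tiles := B.cells.image (B.tile a)
  seed := Config.single B.seed (B.tile a B.seed)
  temp := 2
  temp_pos := two_pos
  seed_over p t h := by
    obtain ⟨-, rfl⟩ := Config.single_eq_some.1 h
    exact Finset.mem_image.2 ⟨_, B.seed_mem, rfl⟩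
  seed_isAssembly := Config.isAssembly_single _ _
  seed_finite := by
    rw [Config.dom_single]
    exact Set.finite_singleton _
  seed_stable := Config.stable_single _ _ _

theorem mem_tiles {B : Blueprint L R} {a : A} {t : TileType A} :
    t ∈ (B.system a).tiles ↔ ∃ p ∈ B.cells, B.tile a p = t := by
  classical exact Finset.mem_image

/-- The assembly `α` consists of the tiles that the blueprint intends, and it is closed under the
dependencies of tiles on their inputs. This is the invariant of all assembly sequences. -/
structure Follows (a : A) (α : Config A) : Prop where
  eq_tile : ∀ p t, α p = some t → p ∈ B.cells ∧ t = B.tile a p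
  isAssembly : α.IsAssembly
  seed_mem : B.seed ∈ α.dom
  input_mem : ∀ p ∈ α.dom, ∀ d, 0 < B.input p d → p + d.vec ∈ α.dom

variable {B} {a : A} {α β : Config A} {p q : Pos} {d : Dir}

theorem follows_seed : B.Follows a (B.system a).seed where
  eq_tile p t h := by
    obtain ⟨rfl, rfl⟩ := Config.single_eq_some.1 h
    exact ⟨B.seed_mem, rfl⟩
  isAssembly := (B.system a).seed_isAssembly
  seed_mem := ⟨_, Config.single_eq_some.2 ⟨rfl, rfl⟩⟩
  input_mem p hp d hd := by
    obtain rfl : p = B.seed := by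
      simpa only [system, Config.dom_single, Set.mem_singleton_iff] using hp
    simp [B.input_seed] at hd

namespace Follows

theorem dom_subset (h : B.Follows a α) : α.dom ⊆ B.cells := fun p ⟨t, ht⟩ => (h.eq_tile p t ht).1

theorem apply_of_mem (h : B.Follows a α) (hp : p ∈ α.dom) : α p = some (B.tile a p) := by
  obtain ⟨t, ht⟩ := hp
  rw [ht, (h.eq_tile p t ht).2]

-- A bond through which the flow leaves the new tile would make the new tile an input of its
-- neighbour, but the inputs of the neighbour are already present.
theorem of_bond_update_pos (h : B.Follows a α) (hp : p ∉ α.dom) (hq : q ∈ B.cells)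
    (hb : 0 < Config.bond (update α p (some (B.tile a q))) p d) :
    p + d.vec ∈ α.dom ∧ B.label p d = B.label q d ∧
      Config.bond (update α p (some (B.tile a q))) p d = B.input q d := by
  obtain ⟨t, u, ht, hu, htu, hbond⟩ := Config.exists_of_bond_pos hb
  rw [Function.update_self, Option.some_inj] at ht
  subst ht
  rw [Function.update_of_ne (Dir.add_vec_ne p d)] at hu
  have hmem : p + d.vec ∈ α.dom := ⟨u, hu⟩
  rw [(h.eq_tile _ _ hu).2, tile, tile, B.label_opp] at htu
  have hpos : 0 < B.strength (B.label q d) := by rwa [hbond] at hb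
  have hlabel : B.label q d = B.label p d := B.eq_of_glue_eq hpos htu
  refine ⟨hmem, hlabel.symm, hbond.trans (B.input_of_flow ?_).symm⟩
  refine (B.flow_axis q hq d hpos).resolve_left fun hflow => hp ?_
  have hin : 0 < B.input (p + d.vec) d.opp := by
    rw [B.input_of_flow] <;> rw [B.label_opp, ← hlabel]
    · exact hpos
    · rw [hflow, Dir.opp_opp]
  simpa only [Dir.add_vec_add_vec_opp] using h.input_mem _ hmem _ hin

theorem label_eq_of_two_le_sum_bond (h : B.Follows a α) (hp : p ∉ α.dom) (hq : q ∈ B.cells)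
    (hb : 2 ≤ ∑ d, Config.bond (update α p (some (B.tile a q))) p d) :
    p ∈ B.cells ∧ B.label p = B.label q ∧ ∀ d, 0 < B.input q d → p + d.vec ∈ α.dom := by
  have hle : ∀ d ∈ Finset.univ,
      Config.bond (update α p (some (B.tile a q))) p d ≤ B.input q d := by
    intro d _
    by_contra! hlt
    exact hlt.ne' (h.of_bond_update_pos hp hq (Nat.zero_lt_of_lt hlt)).2.2
  have hseed : q ≠ B.seed := by
    rintro rfl
    have := hb.trans (Finset.sum_le_sum hle)
    simp [B.input_seed] at this
  have heq := (Finset.sum_eq_sum_iff_of_le hle).1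
    ((Finset.sum_le_sum hle).antisymm ((B.sum_input q hq hseed).trans_le hb))
  have hfit : ∀ d, 0 < B.input q d → p + d.vec ∈ α.dom ∧ B.label p d = B.label q d := by
    intro d hd
    rw [← heq d (Finset.mem_univ d)] at hd
    exact ⟨(h.of_bond_update_pos hp hq hd).1, (h.of_bond_update_pos hp hq hd).2.1⟩
  obtain ⟨hpc, hlabel⟩ := B.determined q hq hseed p fun d hd =>
    ⟨h.dom_subset (hfit d hd).1, (hfit d hd).2⟩
  exact ⟨hpc, hlabel, fun d hd => (hfit d hd).1⟩

theorem step (h : B.Follows a α) (hs : (B.system a).Step α β) : B.Follows a β := by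
  obtain ⟨p, t, ht, hp, rfl, hb⟩ := hs.exists_eq_update
  obtain ⟨q, hq, rfl⟩ := mem_tiles.1 ht
  obtain ⟨hpc, hlabel, hin⟩ := h.label_eq_of_two_le_sum_bond hp hq hb
  have htile : B.tile a q = B.tile a p := by
    unfold tile
    rw [hlabel]
  refine ⟨fun r u hr => ?_, hs.2.1.2.1, ?_, fun r hr d hd => ?_⟩
  · rcases eq_or_ne r p with rfl | hne
    · rw [Function.update_self, Option.some_inj] at hr
      exact ⟨hpc, hr ▸ htile⟩
    · rw [Function.update_of_ne hne] at hr
      exact h.eq_tile r u hr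
  · exact Config.dom_update α p _ ▸ Set.mem_insert_of_mem p h.seed_mem
  · rw [Config.dom_update] at hr ⊢
    refine Set.mem_insert_of_mem p ?_
    rcases hr with rfl | hr
    · refine hin d ?_
      rwa [Labeling.input, hlabel] at hd
    · exact h.input_mem r hr d hd

theorem exists_step (h : B.Follows a α) (hst : α.Stable 2) (hne : ¬ ↑B.cells ⊆ α.dom) :
    ∃ β, (B.system a).Step α β := by
  classical
  obtain ⟨r, hr, hrα⟩ := Set.not_subset.1 hne
  obtain ⟨p, hp, hmin⟩ := (B.cells.filter (· ∉ α.dom)).exists_min_image B.rank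
    ⟨r, Finset.mem_filter.2 ⟨hr, hrα⟩⟩
  obtain ⟨hpc, hpα⟩ := Finset.mem_filter.1 hp
  have hbond : ∀ d, B.input p d ≤ Config.bond (update α p (some (B.tile a p))) p d := by
    intro d
    rcases (Nat.zero_le (B.input p d)).eq_or_lt with h0 | hpos
    · exact h0 ▸ Nat.zero_le _
    obtain ⟨hc, hlt⟩ := B.input_mem p hpc d hpos
    have hmem : p + d.vec ∈ α.dom := by
      by_contra hα
      exact hlt.not_ge (hmin _ (Finset.mem_filter.2 ⟨hc, hα⟩))
    have hnb : update α p (some (B.tile a p)) (p + d.vec) = some (B.tile a (p + d.vec)) := by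
      rw [Function.update_of_ne (Dir.add_vec_ne p d), h.apply_of_mem hmem]
    rw [Config.bond_of_eq (Function.update_self ..) hnb (by rw [tile, tile, B.label_opp]),
      B.input_of_flow (Labeling.flow_of_input_pos hpos)]
    rfl
  have hsum : ∑ d, B.input p d = 2 :=
    B.sum_input p hpc fun hseed => hpα (hseed ▸ h.seed_mem)
  refine ⟨_, TAS.step_update (fun q t hq => ?_) h.isAssembly hst hpα (mem_tiles.2 ⟨p, hpc, rfl⟩)
    (hsum.symm.le.trans (Finset.sum_le_sum fun d _ => hbond d))⟩
  obtain ⟨hqc, rfl⟩ := h.eq_tile q t hq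
  exact mem_tiles.2 ⟨q, hqc, rfl⟩

theorem of_producible (h : (B.system a).Producible α) : B.Follows a α := by
  rcases h with h | ⟨s, hs0, hs, -⟩
  · induction h with
    | refl => exact follows_seed
    | tail _ hs ih => exact ih.step hs
  have hfol : ∀ k, B.Follows a (s k) := by
    intro k
    induction k with
    | zero => exact hs0 ▸ follows_seed
    | succ k ih => exact ih.step (hs k)
  have hmono : StrictMono fun k => (s k).dom.ncard := strictMono_nat_of_lt_succ fun k =>
    (hs k).ncard_dom_lt (B.cells.finite_toSet.subset (hfol (k + 1)).dom_subset)
  have hbound := Set.ncard_le_ncard (hfol (B.cells.card + 1)).dom_subset B.cells.finite_toSet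
  rw [Set.ncard_coe_finset] at hbound
  exact absurd (hmono.le_apply.trans hbound) (Nat.lt_irrefl _)

theorem dom_eq_of_terminal (h : B.Follows a α) (ht : (B.system a).Terminal α) :
    α.dom = B.cells := by
  refine h.dom_subset.antisymm ?_
  by_contra hne
  exact ht.2 (h.exists_step ht.1 hne)

end Follows

theorem weaklySelfAssembles {C : Type*} (B : Blueprint L R) (a : A) (color : TileType A → C) :
    (B.system a).WeaklySelfAssembles color Set.univ
      {x | x.1 ∈ B.cells ∧ x.2 = color (B.tile a x.1)} := by
  intro α hprod hterm
  have hα := Follows.of_producible hprod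
  have hdom := hα.dom_eq_of_terminal hterm
  refine ⟨?_, fun p c ⟨hp, hc⟩ => ⟨_, hα.apply_of_mem (hdom ▸ hp), hc.symm⟩⟩
  ext p
  have hmem : p ∈ α.dom ↔ p ∈ B.cells := by rw [hdom, Finset.mem_coe]
  simpa [Config.dom] using hmem

end System

end Blueprint

section Symmetry

/-- A symmetry of the lattice: a permutation of the locations that carries the side `d` of every
location to the side `dir d` of its image. -/
structure Symmetry where
  pos : Pos ≃ Pos
  dir : Dir ≃ Dir
  pos_add_vec : ∀ p d, pos (p + d.vec) = pos p + (dir d).vec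

namespace Symmetry

theorem dir_opp (g : Symmetry) (d : Dir) : g.dir d.opp = (g.dir d).opp := by
  refine Dir.vec_injective ?_
  have h := g.pos_add_vec (0 + d.vec) d.opp
  rw [Dir.add_vec_add_vec_opp, g.pos_add_vec, add_assoc, left_eq_add] at h
  rw [Dir.vec_opp, eq_neg_of_add_eq_zero_right h]

/-- The reflection at a horizontal line that exchanges the rows `y` and `c - y`. -/
def reflection (c : ℤ) : Symmetry where
  pos := (Equiv.refl ℤ).prodCongr (Equiv.subLeft c)
  dir :=
    { toFun := fun
        | .north => .south
        | .south => .north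
        | d => d
      invFun := fun
        | .north => .south
        | .south => .north
        | d => d
      left_inv := by rintro ⟨⟩ <;> rfl
      right_inv := by rintro ⟨⟩ <;> rfl }
  pos_add_vec p d := by cases d <;> ext <;> simp [Dir.vec] <;> ring

end Symmetry

variable {A L R : Type*} [LinearOrder R]

/-- The labelling pulled back along a symmetry. -/
def Labeling.comap (F : Labeling L) (g : Symmetry) : Labeling L where
  label p d := F.label (g.pos p) (g.dir d)
  strength := F.strength
  flow l := g.dir.symm (F.flow l)
  label_opp p d := by rw [g.pos_add_vec, g.dir_opp, F.label_opp]

theorem Labeling.input_comap (F : Labeling L) (g : Symmetry) (p : Pos) (d : Dir) :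
    (F.comap g).input p d = F.input (g.pos p) (g.dir d) := by
  simp only [input, comap, Equiv.symm_apply_eq, g.dir_opp]

namespace Blueprint

/-- The blueprint pulled back along a symmetry. -/
def comap (B : Blueprint L R) (g : Symmetry) : Blueprint L R where
  toLabeling := B.toLabeling.comap g
  cells := B.cells.map g.pos.symm.toEmbedding
  seed := g.pos.symm B.seed
  rank p := B.rank (g.pos p)
  seed_mem := Finset.mem_map_of_mem _ B.seed_mem
  flow_axis p hp d h := by
    rw [Finset.mem_map_equiv] at hp
    refine (B.flow_axis _ hp _ h).imp (fun h => ?_) fun h => ?_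
    · exact g.dir.symm_apply_eq.2 h
    · exact g.dir.symm_apply_eq.2 (h.trans (g.dir_opp d).symm)
  input_seed d := by rw [Labeling.input_comap, g.pos.apply_symm_apply, B.input_seed]
  sum_input p hp hne := by
    rw [Finset.mem_map_equiv] at hp
    simp only [Labeling.input_comap]
    rw [Equiv.sum_comp g.dir (B.input (g.pos p))]
    exact B.sum_input _ hp fun h => hne (g.pos.symm_apply_eq.2 h.symm).symm
  input_mem p hp d hd := by
    rw [Finset.mem_map_equiv] at hp ⊢
    rw [Labeling.input_comap] at hd
    simpa only [Equiv.symm_symm, g.pos_add_vec] using B.input_mem _ hp _ hd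
  determined q hq hne p h := by
    simp only [Finset.mem_map_equiv, Labeling.input_comap, Equiv.symm_symm, g.pos_add_vec] at *
    obtain ⟨hp, hlabel⟩ := B.determined (g.pos q) hq
      (fun h => hne (g.pos.symm_apply_eq.2 h.symm).symm) (g.pos p) fun d hd => by
        simpa [Labeling.comap] using h (g.dir.symm d) (by simpa using hd)
    exact ⟨hp, funext fun d => congrFun hlabel (g.dir d)⟩

theorem tile_comap [Countable L] (B : Blueprint L R) (g : Symmetry) (a : A) (p : Pos) :
    (B.comap g).tile a p = B.tile a (g.pos p) ∘ g.dir := rfl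

theorem card_tiles_comap_le [Countable L] (B : Blueprint L R) (g : Symmetry) (a : A) :
    ((B.comap g).system a).tiles.card ≤ (B.system a).tiles.card := by
  classical
  refine le_trans (Finset.card_le_card fun t ht => ?_)
    (Finset.card_image_le (f := fun t : TileType A => t ∘ g.dir))
  obtain ⟨p, hp, rfl⟩ := mem_tiles.1 ht
  exact Finset.mem_image.2 ⟨B.tile a (g.pos p),
    mem_tiles.2 ⟨_, Finset.mem_map_equiv.1 hp, rfl⟩, rfl⟩

end Blueprint

end Symmetry

section Discrete

variable {A L R : Type*} [LinearOrder R]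

theorem eq_of_edge_eq {p q : Pos} {d : Dir} (h : s(p, p + d.vec) = s(q, q + d.vec)) : p = q := by
  obtain ⟨h, -⟩ | ⟨h₁, h₂⟩ := Sym2.eq_iff.1 h
  · exact h
  · rw [h₁, add_assoc, add_eq_left] at h₂
    cases d <;> simp [Dir.vec, Prod.ext_iff] at h₂

/-- The labelling that additionally writes the position of each edge into its label. -/
def Labeling.discrete (F : Labeling L) : Labeling (L × Sym2 Pos) where
  label p d := (F.label p d, s(p, p + d.vec))
  strength l := F.strength l.1
  flow l := F.flow l.1
  label_opp p d := by rw [F.label_opp, Dir.add_vec_add_vec_opp, Sym2.eq_swap]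

namespace Blueprint

theorem exists_input_pos (B : Blueprint L R) {p : Pos} (hp : p ∈ B.cells) (hne : p ≠ B.seed) :
    ∃ d, 0 < B.input p d := by
  obtain ⟨d, -, hd⟩ := Finset.exists_ne_zero_of_sum_ne_zero
    ((B.sum_input p hp hne).trans_ne two_ne_zero)
  exact ⟨d, Nat.pos_of_ne_zero hd⟩

/-- The blueprint with the same assembly in which every location has a tile type of its own. -/
def discrete (B : Blueprint L R) : Blueprint (L × Sym2 Pos) R where
  toLabeling := B.toLabeling.discrete
  cells := B.cells
  seed := B.seed
  rank := B.rank
  seed_mem := B.seed_mem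
  flow_axis := B.flow_axis
  input_seed := B.input_seed
  sum_input := B.sum_input
  input_mem := B.input_mem
  determined q hq hne p h := by
    obtain ⟨d, hd⟩ := B.exists_input_pos hq hne
    obtain rfl := eq_of_edge_eq (congrArg Prod.snd (h d hd).2)
    exact ⟨hq, rfl⟩

theorem tile_apply_eq [Countable L] {B : Blueprint L R} {a : A} {p q : Pos} {d : Dir}
    (h : B.tile a p = B.tile a q) (hd : 0 < B.strength (B.label q d)) :
    B.label p d = B.label q d :=
  (B.eq_of_glue_eq hd (congrFun h.symm d)).symm

theorem tile_discrete_injOn [Countable L] (B : Blueprint L R) (a : A) :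
    Set.InjOn (B.discrete.tile a) B.cells := by
  have hlabel : ∀ p, ∀ q ∈ B.cells, q ≠ B.seed →
      B.discrete.tile a p = B.discrete.tile a q → p = q := by
    intro p q hq hne h
    obtain ⟨d, hd⟩ := B.exists_input_pos hq hne
    rw [Labeling.input_of_flow _ (Labeling.flow_of_input_pos hd)] at hd
    exact eq_of_edge_eq (congrArg Prod.snd (tile_apply_eq h hd))
  intro p hp q hq h
  by_cases hne : q = B.seed
  · by_contra hpq
    exact hpq (hlabel q p hp (fun hp' => hpq (hp'.trans hne.symm)) h.symm).symm
  · exact hlabel p q hq hne h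

end Blueprint

end Discrete

section SinglePixel

/-- The `n × n` square as a finite set of locations. -/
noncomputable def square (n : ℤ) : Finset Pos := Finset.Ico 0 n ×ˢ Finset.Ico 0 n

theorem mem_square {n : ℤ} {p : Pos} :
    p ∈ square n ↔ (0 ≤ p.1 ∧ p.1 < n) ∧ 0 ≤ p.2 ∧ p.2 < n := by
  simp [square]

/-- Some temperature-`2` system with a single seed tile and at most `m` tile types weakly
self-assembles the `n × n` single-pixel pattern. -/
def HasSinglePixelSystem (A : Type*) (n i j m : ℕ) : Prop :=
  ∃ (𝒯 : TAS A) (color : TileType A → Color),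
    𝒯.temp = 2 ∧ 𝒯.seed.dom.ncard = 1 ∧ 𝒯.tiles.card ≤ m ∧
      𝒯.WeaklySelfAssembles color Set.univ (singlePixel n i j)

theorem HasSinglePixelSystem.mono {A : Type*} {n i j m m' : ℕ}
    (h : HasSinglePixelSystem A n i j m) (hm : m ≤ m') : HasSinglePixelSystem A n i j m' := by
  obtain ⟨𝒯, color, htemp, hseed, hcard, hassembles⟩ := h
  exact ⟨𝒯, color, htemp, hseed, hcard.trans hm, hassembles⟩

variable {A L R : Type*} [LinearOrder R] [Countable L] {B : Blueprint L R} {a : A} {n i j m : ℕ}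

/-- The tile type of the location `q` is used at no other location. -/
def Blueprint.TileUnique (B : Blueprint L R) (a : A) (q : Pos) : Prop :=
  ∀ p ∈ B.cells, B.tile a p = B.tile a q → p = q

theorem Blueprint.hasSinglePixelSystem (hcells : B.cells = square n) (hij : B.TileUnique a (i, j))
    (hcard : (B.system a).tiles.card ≤ m) : HasSinglePixelSystem A n i j m := by
  classical
  refine ⟨B.system a, fun t => if t = B.tile a (i, j) then .black else .white, rfl, ?_, hcard, ?_⟩
  · rw [system, Config.dom_single, Set.ncard_singleton]
  convert B.weaklySelfAssembles a _ using 1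
  ext ⟨p, c⟩
  have htile (hp : p ∈ B.cells) : B.tile a p = B.tile a (i, j) ↔ p = (↑i, ↑j) :=
    ⟨hij p hp, fun h => h ▸ rfl⟩
  rw [singlePixel, Set.mem_ofPred_eq, Set.mem_ofPred_eq, ← and_assoc, ← mem_square, ← hcells]
  exact and_congr_right fun hp => by simp only [htile hp]

theorem Blueprint.hasSinglePixelSystem_reflection (hcells : B.cells = square n) (hj : j < n)
    (hij : B.TileUnique a (i, (n - 1 - j : ℕ))) (hcard : (B.system a).tiles.card ≤ m) :
    HasSinglePixelSystem A n i j m := by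
  set g := Symmetry.reflection (n - 1)
  have hg (p : Pos) : g.pos p = (p.1, n - 1 - p.2) := rfl
  have hgij : g.pos (i, j) = (↑i, ((n - 1 - j : ℕ) : ℤ)) := by
    rw [hg]
    ext <;> simp
    omega
  have hcomap (p : Pos) : p ∈ (B.comap g).cells ↔ g.pos p ∈ B.cells := Finset.mem_map_equiv
  refine (B.comap g).hasSinglePixelSystem (a := a) ?_ (fun p hp h => ?_)
    ((B.card_tiles_comap_le g a).trans hcard)
  · ext p
    rw [hcomap, hcells, hg, mem_square, mem_square]
    omega
  · rw [tile_comap, tile_comap, hgij] at h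
    refine g.pos.injective ((hij _ ((hcomap p).1 hp) ?_).trans hgij.symm)
    exact g.dir.surjective.injective_comp_right h

end SinglePixel

section PlaceValue

/-- The value of a binary digit `1` in row `y` of the counter. -/
def placeValue (y : ℤ) : ℤ := 2 ^ y.toNat

/-- The binary digit of `z` in row `y`. -/
def bit (y z : ℤ) : Bool := z / placeValue y % 2 = 1

variable {x y z w : ℤ}

theorem placeValue_zero : placeValue 0 = 1 := rfl

theorem placeValue_pos (y : ℤ) : 0 < placeValue y := pow_pos two_pos _

theorem placeValue_add_one (hy : 0 ≤ y) : placeValue (y + 1) = placeValue y * 2 := by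
  rw [placeValue, Int.toNat_add hy zero_le_one, Int.toNat_one, pow_succ, placeValue]

theorem lt_placeValue (hy : 0 ≤ y) : y < placeValue y := by
  conv_lhs => rw [← Int.toNat_of_nonneg hy]
  rw [placeValue]
  exact_mod_cast Nat.lt_two_pow_self

theorem placeValue_dvd_of_add_one_dvd (hy : 0 ≤ y) (h : placeValue (y + 1) ∣ z) :
    placeValue y ∣ z :=
  (placeValue_add_one hy ▸ dvd_mul_right _ _ : placeValue y ∣ placeValue (y + 1)).trans h

theorem placeValue_add_one_dvd_sub_iff (hy : 0 ≤ y) :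
    placeValue (y + 1) ∣ z - w ↔ placeValue y ∣ z - w ∧ bit y z = bit y w := by
  rw [← and_iff_right_of_imp (placeValue_dvd_of_add_one_dvd (z := z - w) hy)]
  refine and_congr_right fun ⟨c, hc⟩ => ?_
  have hz : z / placeValue y = w / placeValue y + c := by
    rw [← Int.add_mul_ediv_left w c (placeValue_pos y).ne', ← hc, add_sub_cancel]
  rw [hc, placeValue_add_one hy, Int.mul_dvd_mul_iff_left (placeValue_pos y).ne', bit, bit,
    decide_eq_decide, hz]
  omega

theorem bit_sub_one (h : ¬ placeValue y ∣ z) : bit y (z - 1) = bit y z := by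
  have hpos := (Int.emod_nonneg z (placeValue_pos y).ne').lt_of_ne'
    (mt Int.dvd_of_emod_eq_zero h)
  have hlt := Int.emod_lt_of_pos z (placeValue_pos y)
  have hdiv : (z - 1) / placeValue y = z / placeValue y := by
    refine ((Int.ediv_emod_unique (r := z % placeValue y - 1) (placeValue_pos y)).2 ⟨?_, ?_⟩).1
    · linear_combination Int.emod_add_mul_ediv z (placeValue y)
    · omega
  rw [bit, bit, hdiv]

theorem placeValue_add_one_dvd_sub_of_not_dvd (hy : 0 ≤ y) (hz : placeValue y ∣ z)
    (hz' : ¬ placeValue (y + 1) ∣ z) (hw : placeValue y ∣ w) (hw' : ¬ placeValue (y + 1) ∣ w) :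
    placeValue (y + 1) ∣ z - w := by
  obtain ⟨c, rfl⟩ := hz
  obtain ⟨d, rfl⟩ := hw
  rw [placeValue_add_one hy, Int.mul_dvd_mul_iff_left (placeValue_pos y).ne'] at *
  rw [← mul_sub, Int.mul_dvd_mul_iff_left (placeValue_pos y).ne']
  omega

end PlaceValue

/-! ### The counter and the body -/

/-- The parameters of a construction of the `n × n` square with a distinguished location `(i, j)`:
the rows `y < k` hold a binary counter, and the rows `y ≥ k` are the body of the square. -/
structure Layout where
  n : ℤ
  k : ℤ
  i : ℤ
  j : ℤ
  k_pos : 0 < k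
  k_le : k ≤ n
  n_le : n ≤ placeValue k
  i_mem : i ∈ Set.Ico 0 n
  j_mem : j ∈ Set.Ico 0 n

/-- The columns that the counter recognizes: the last one, the one where the diagonal of the body
starts, the column of the pixel, and the column where the diagonal meets the row of the pixel. -/
inductive Target
  | last | diagonal | column | row
deriving DecidableEq

instance : Fintype Target :=
  ⟨{.last, .diagonal, .column, .row}, by rintro ⟨⟩ <;> simp⟩

/-- The information that crosses an edge. -/
inductive Mark
  | null
  | start
  | down
  | strong
  | digit (b : Bool)
  | agree (f : Target → Bool)
  | up (diagonal column row : Bool)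
  | east (diagonal row : Bool)
  | west (row : Bool)
deriving DecidableEq, Fintype

namespace Mark

/-- The strength of the glues that carry a mark. -/
def strength : Mark → ℕ
  | null => 0
  | start | down | strong | up true _ _ => 2
  | _ => 1

/-- The direction in which a mark travels. -/
def flow : Mark → Dir
  | down => .south
  | strong | digit _ | east .. => .east
  | west _ => .west
  | _ => .north

end Mark

namespace Layout

variable (P : Layout)

/-- The position of a recognized column. -/
def target : Target → ℤ
  | .last => P.n - 1
  | .diagonal => P.k
  | .column => P.i
  | .row => P.j

/-- The mark on the south side of `(x, y)`. In the counter, the column `x` holds the binary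
expansion of `n - x`, and an `agree` mark compares the digits of `x` below it with those of the
targets. -/
def southMark (x y : ℤ) : Mark :=
  if y ≤ 0 then .null
  else if y < P.k then
    if x = 0 then .start
    else if placeValue y ∣ P.n - x then .down
    else .agree fun t => placeValue y ∣ P.target t - x
  else .up (x = y) (x = P.i) (x = P.j)

/-- The mark on the west side of `(x, y)`. -/
def westMark (x y : ℤ) : Mark :=
  if y < P.k then
    if x ≤ 0 then .null
    else if placeValue (y + 1) ∣ P.n - x then .null
    else if placeValue y ∣ P.n - x then .strong
    else .digit (bit y (P.n - x))
  else if y < x then .east (x = y + 1) (y = P.j)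
  else .west (y = P.j)

/-- Labels consist of a mark and a row number; the rows of the body share the number `k`. -/
def labeling : Labeling (Mark × ℤ) where
  label p
    | .north => (P.southMark p.1 (p.2 + 1), min (p.2 + 1) P.k)
    | .east => (P.westMark (p.1 + 1) p.2, min p.2 P.k)
    | .south => (P.southMark p.1 p.2, min p.2 P.k)
    | .west => (P.westMark p.1 p.2, min p.2 P.k)
  strength l := l.1.strength
  flow l := l.1.flow
  label_opp p d := by cases d <;> simp [Dir.vec, Dir.opp]

/-- The kinds of locations, which differ in the sides that receive information. -/
inductive Kind
  | seed | start | down | strong | digit | diagonal | right | left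

/-- The strength of the information that a location of a given kind receives through a side. -/
def Kind.input : Kind → Dir → ℕ
  | .start, .south | .diagonal, .south => 2
  | .down, .north => 2
  | .strong, .west => 2
  | .digit, .south | .digit, .west => 1
  | .right, .south | .right, .west => 1
  | .left, .south | .left, .east => 1
  | _, _ => 0

/-- The kind of the location `p`. -/
def kind (p : Pos) : Kind :=
  if p.2 < P.k then
    if p.1 = 0 then if p.2 = 0 then .seed else .start
    else if placeValue (p.2 + 1) ∣ P.n - p.1 then .down
    else if placeValue p.2 ∣ P.n - p.1 then .strong
    else .digit
  else if p.1 = p.2 then .diagonal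
  else if p.2 < p.1 then .right
  else .left

section Marks

variable {P} {x y : ℤ}

theorem southMark_eq_start_iff : P.southMark x y = .start ↔ (0 < y ∧ y < P.k) ∧ x = 0 := by
  unfold southMark
  split_ifs <;> simp <;> omega

theorem southMark_eq_down_iff :
    P.southMark x y = .down ↔ (0 < y ∧ y < P.k) ∧ x ≠ 0 ∧ placeValue y ∣ P.n - x := by
  unfold southMark
  split_ifs <;> simp_all

theorem southMark_eq_agree_iff {f : Target → Bool} :
    P.southMark x y = .agree f ↔ (0 < y ∧ y < P.k) ∧ (x ≠ 0 ∧ ¬ placeValue y ∣ P.n - x) ∧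
      ∀ t, f t = decide (placeValue y ∣ P.target t - x) := by
  unfold southMark
  split_ifs <;> simp_all [funext_iff, eq_comm]

theorem southMark_eq_up_iff {a b c : Bool} :
    P.southMark x y = .up a b c ↔ P.k ≤ y ∧
      a = decide (x = y) ∧ b = decide (x = P.i) ∧ c = decide (x = P.j) := by
  have := P.k_pos
  unfold southMark
  split_ifs <;> simp <;> grind

theorem southMark_of_le (hy : P.k ≤ y) :
    P.southMark x y = .up (x = y) (x = P.i) (x = P.j) :=
  southMark_eq_up_iff.2 ⟨hy, rfl, rfl, rfl⟩

theorem westMark_eq_strong_iff :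
    P.westMark x y = .strong ↔ y < P.k ∧ 0 < x ∧ placeValue y ∣ P.n - x ∧
      ¬ placeValue (y + 1) ∣ P.n - x := by
  unfold westMark
  split_ifs <;> simp_all

theorem westMark_eq_digit_iff {b : Bool} :
    P.westMark x y = .digit b ↔ y < P.k ∧ 0 < x ∧ ¬ placeValue y ∣ P.n - x ∧
      ¬ placeValue (y + 1) ∣ P.n - x ∧ b = bit y (P.n - x) := by
  unfold westMark
  split_ifs <;> simp_all [eq_comm]

theorem westMark_eq_east_iff {a b : Bool} :
    P.westMark x y = .east a b ↔ P.k ≤ y ∧ y < x ∧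
      a = decide (x = y + 1) ∧ b = decide (y = P.j) := by
  unfold westMark
  split_ifs <;> simp <;> grind

theorem westMark_eq_west_iff {b : Bool} :
    P.westMark x y = .west b ↔ P.k ≤ y ∧ x ≤ y ∧ b = decide (y = P.j) := by
  unfold westMark
  split_ifs <;> simp <;> grind

end Marks

section Kinds

variable {P} {p : Pos}

theorem kind_eq_seed_iff : P.kind p = .seed ↔ p.2 < P.k ∧ p.1 = 0 ∧ p.2 = 0 := by
  grind [kind]

theorem kind_eq_start_iff : P.kind p = .start ↔ p.2 < P.k ∧ p.1 = 0 ∧ p.2 ≠ 0 := by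
  grind [kind]

theorem kind_eq_down_iff :
    P.kind p = .down ↔ p.2 < P.k ∧ p.1 ≠ 0 ∧ placeValue (p.2 + 1) ∣ P.n - p.1 := by
  grind [kind]

theorem kind_eq_strong_iff : P.kind p = .strong ↔ p.2 < P.k ∧ p.1 ≠ 0 ∧
    placeValue p.2 ∣ P.n - p.1 ∧ ¬ placeValue (p.2 + 1) ∣ P.n - p.1 := by
  grind [kind]

theorem kind_eq_digit_iff : P.kind p = .digit ↔ p.2 < P.k ∧ p.1 ≠ 0 ∧
    ¬ placeValue p.2 ∣ P.n - p.1 ∧ ¬ placeValue (p.2 + 1) ∣ P.n - p.1 := by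
  grind [kind]

theorem kind_eq_diagonal_iff : P.kind p = .diagonal ↔ P.k ≤ p.2 ∧ p.1 = p.2 := by
  grind [kind]

theorem kind_eq_right_iff : P.kind p = .right ↔ P.k ≤ p.2 ∧ p.2 < p.1 := by
  grind [kind]

theorem kind_eq_left_iff : P.kind p = .left ↔ P.k ≤ p.2 ∧ p.1 < p.2 := by
  grind [kind]

end Kinds

theorem add_one_ne_of_dvd {p : Pos} (hp : p ∈ square P.n) (hx : p.1 ≠ 0)
    (h : placeValue (p.2 + 1) ∣ P.n - p.1) : p.2 + 1 ≠ P.k := by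
  obtain ⟨⟨hx0, hxn⟩, -⟩ := mem_square.1 hp
  intro hk
  have := Int.le_of_dvd (by omega) h
  have := P.n_le
  rw [hk] at *
  omega

variable {P} {p : Pos}

theorem input_north (hp : p ∈ square P.n) :
    P.labeling.input p .north = (P.kind p).input .north := by
  have hy := (mem_square.1 hp).2.1
  have htop := P.add_one_ne_of_dvd hp
  simp only [Labeling.input, labeling, Dir.opp, kind, southMark]
  split_ifs <;> grind [Mark.flow, Mark.strength, Kind.input]

theorem input_south (hp : p ∈ square P.n) :
    P.labeling.input p .south = (P.kind p).input .south := by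
  have hy := (mem_square.1 hp).2.1
  have hk := P.k_pos
  have hdvd := placeValue_dvd_of_add_one_dvd (z := P.n - p.1) hy
  have hzero (h : p.2 = 0) : placeValue p.2 ∣ P.n - p.1 := by simp [h, placeValue_zero]
  simp only [Labeling.input, labeling, Dir.opp, kind, southMark]
  split_ifs <;> grind [Mark.flow, Mark.strength, Kind.input]

theorem input_east (p : Pos) : P.labeling.input p .east = (P.kind p).input .east := by
  simp only [Labeling.input, labeling, Dir.opp, kind, westMark]
  split_ifs <;> grind [Mark.flow, Mark.strength, Kind.input]

theorem input_west (hp : p ∈ square P.n) :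
    P.labeling.input p .west = (P.kind p).input .west := by
  have hx := (mem_square.1 hp).1.1
  simp only [Labeling.input, labeling, Dir.opp, kind, westMark]
  split_ifs <;> grind [Mark.flow, Mark.strength, Kind.input]

theorem input_eq (hp : p ∈ square P.n) (d : Dir) :
    P.labeling.input p d = (P.kind p).input d := by
  cases d
  exacts [input_north hp, input_east p, input_south hp, input_west hp]

variable {q : Pos}

section Congruence

variable {x x' y : ℤ}

theorem eq_target_iff (hx : x ∈ Set.Ico 0 P.n) (t : Target) :
    placeValue P.k ∣ P.target t - x ↔ x = P.target t := by
  refine ⟨fun h => ?_, fun h => h ▸ by simp⟩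
  have ht : P.target t ∈ Set.Ico 0 (placeValue P.k) := by
    have := P.n_le
    have := lt_placeValue P.k_pos.le
    have := P.k_pos
    have := P.i_mem
    have := P.j_mem
    cases t <;> simp only [target, Set.mem_Ico] at * <;> omega
  have hlt : |P.target t - x| < placeValue P.k :=
    abs_sub_lt_of_nonneg_of_lt ht.1 ht.2 hx.1 (hx.2.trans_le P.n_le)
  exact (sub_eq_zero.1 (Int.eq_zero_of_abs_lt_dvd h hlt)).symm

theorem southMark_congr (hx : x ∈ Set.Ioo 0 P.n) (hx' : x' ∈ Set.Ioo 0 P.n) (hy : y ≤ P.k)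
    (hn : placeValue y ∣ P.n - x ↔ placeValue y ∣ P.n - x')
    (ht : ∀ t, placeValue y ∣ P.target t - x ↔ placeValue y ∣ P.target t - x') :
    P.southMark x y = P.southMark x' y := by
  rcases hy.lt_or_eq with hy | rfl
  · simp only [southMark, hy, hx.1.ne', hx'.1.ne', hn, ht, if_true, if_false]
  · simp only [eq_target_iff (Set.Ioo_subset_Ico_self hx),
      eq_target_iff (Set.Ioo_subset_Ico_self hx')] at ht
    have hk := ht .diagonal
    have hi := ht .column
    have hj := ht .row
    simp only [target] at hk hi hj
    simp only [southMark, lt_self_iff_false, if_false, hk, hi, hj]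

theorem westMark_congr (hx : 0 < x) (hx' : 0 < x') (hy : 0 ≤ y) (hyk : y < P.k)
    (hn : placeValue y ∣ P.n - x ↔ placeValue y ∣ P.n - x')
    (hbit : bit y (P.n - x) = bit y (P.n - x')) : P.westMark x y = P.westMark x' y := by
  have hn' : placeValue (y + 1) ∣ P.n - x ↔ placeValue (y + 1) ∣ P.n - x' := by
    have h := fun z => placeValue_add_one_dvd_sub_iff (z := z) (w := 0) hy
    simp only [sub_zero] at h
    rw [h, h, hn, hbit]
  simp only [westMark, hyk, hx.not_ge, hx'.not_ge, hn, hn', hbit, if_true, if_false]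

end Congruence

theorem label_ext (hrow : min p.2 P.k = min q.2 P.k)
    (hnorth : P.southMark p.1 (p.2 + 1) = P.southMark q.1 (q.2 + 1))
    (heast : P.westMark (p.1 + 1) p.2 = P.westMark (q.1 + 1) q.2)
    (hsouth : P.southMark p.1 p.2 = P.southMark q.1 q.2)
    (hwest : P.westMark p.1 p.2 = P.westMark q.1 q.2) :
    P.labeling.label p = P.labeling.label q := by
  funext d
  cases d
  · exact Prod.ext hnorth (by simp only [labeling]; omega)
  · exact Prod.ext heast hrow
  · exact Prod.ext hsouth hrow
  · exact Prod.ext hwest hrow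

theorem label_eq_of_placeValue_dvd {x x' y : ℤ} (hx : x ∈ Set.Ioo 0 P.n)
    (hx' : x' ∈ Set.Ioo 0 P.n) (hy : 0 ≤ y) (hyk : y < P.k)
    (h : placeValue (y + 1) ∣ x - x') : P.labeling.label (x, y) = P.labeling.label (x', y) := by
  have h₁ (c : ℤ) : placeValue (y + 1) ∣ c - x ↔ placeValue (y + 1) ∣ c - x' := by
    rw [← dvd_neg, neg_sub, ← dvd_neg (b := c - x'), neg_sub]
    exact dvd_iff_dvd_of_dvd_sub (by rwa [sub_sub_sub_cancel_right])
  have h₀ (c : ℤ) : placeValue y ∣ c - x ↔ placeValue y ∣ c - x' := by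
    rw [← dvd_neg, neg_sub, ← dvd_neg (b := c - x'), neg_sub]
    exact dvd_iff_dvd_of_dvd_sub
      (by rw [sub_sub_sub_cancel_right]; exact placeValue_dvd_of_add_one_dvd hy h)
  have hbit (c : ℤ) : bit y (c - x) = bit y (c - x') := by
    refine ((placeValue_add_one_dvd_sub_iff hy).1 ?_).2
    rwa [sub_sub_sub_cancel_left, dvd_sub_comm]
  refine label_ext rfl (southMark_congr hx hx' hyk (h₁ _) fun t => h₁ _) ?_
    (southMark_congr hx hx' hyk.le (h₀ _) fun t => h₀ _)
    (westMark_congr hx.1 hx'.1 hy hyk (h₀ _) (hbit _))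
  refine westMark_congr ?_ ?_ hy hyk ?_ ?_
  · exact hx.1.trans (lt_add_one x)
  · exact hx'.1.trans (lt_add_one x')
  · rw [sub_add_eq_sub_sub_swap, sub_add_eq_sub_sub_swap, h₀]
  · rw [sub_add_eq_sub_sub_swap, sub_add_eq_sub_sub_swap, hbit]

theorem label_eq_of_le (hp : P.k ≤ p.2) (hq : P.k ≤ q.2) (hdiag : p.1 = p.2 ↔ q.1 = q.2)
    (hlt : p.2 < p.1 ↔ q.2 < q.1) (hnext : p.1 = p.2 + 1 ↔ q.1 = q.2 + 1)
    (hi : p.1 = P.i ↔ q.1 = P.i) (hj : p.1 = P.j ↔ q.1 = P.j) (hrow : p.2 = P.j ↔ q.2 = P.j) :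
    P.labeling.label p = P.labeling.label q := by
  refine label_ext (by omega) ?_ ?_ ?_ ?_
  · rw [southMark_of_le (by omega), southMark_of_le (by omega)]
    simp only [hnext, hi, hj]
  · have hle : p.2 < p.1 + 1 ↔ q.2 < q.1 + 1 := by omega
    simp only [westMark, hp.not_gt, hq.not_gt, hle, add_left_inj, hdiag, hrow, if_false]
  · rw [southMark_of_le hp, southMark_of_le hq]
    simp only [hdiag, hi, hj]
  · simp only [westMark, hp.not_gt, hq.not_gt, hlt, hnext, hrow, if_false]

section Determined

/-- The tile for `q` fits the side `d` of the location `p` next to a location of the square. -/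
def Fits (P : Layout) (q p : Pos) (d : Dir) : Prop :=
  p + d.vec ∈ square P.n ∧ P.labeling.label p d = P.labeling.label q d

theorem fits_north_iff : P.Fits q p .north ↔ (p.1, p.2 + 1) ∈ square P.n ∧
    P.southMark p.1 (p.2 + 1) = P.southMark q.1 (q.2 + 1) ∧
      min (p.2 + 1) P.k = min (q.2 + 1) P.k := by
  simp [Fits, labeling, Dir.vec, mem_square]

theorem fits_east_iff : P.Fits q p .east ↔ (p.1 + 1, p.2) ∈ square P.n ∧
    P.westMark (p.1 + 1) p.2 = P.westMark (q.1 + 1) q.2 ∧ min p.2 P.k = min q.2 P.k := by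
  simp [Fits, labeling, Dir.vec, mem_square]

theorem fits_south_iff : P.Fits q p .south ↔ (p.1, p.2 - 1) ∈ square P.n ∧
    P.southMark p.1 p.2 = P.southMark q.1 q.2 ∧ min p.2 P.k = min q.2 P.k := by
  simp [Fits, labeling, Dir.vec, mem_square, sub_eq_add_neg]

theorem fits_west_iff : P.Fits q p .west ↔ (p.1 - 1, p.2) ∈ square P.n ∧
    P.westMark p.1 p.2 = P.westMark q.1 q.2 ∧ min p.2 P.k = min q.2 P.k := by
  simp [Fits, labeling, Dir.vec, mem_square, sub_eq_add_neg]

theorem determined_start (hq : q ∈ square P.n) (hkind : P.kind q = .start)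
    (hsouth : P.Fits q p .south) : p = q := by
  obtain ⟨-, hmark, hrow⟩ := fits_south_iff.1 hsouth
  have hqk := kind_eq_start_iff.1 hkind
  have hqy := (mem_square.1 hq).2.1
  rw [southMark_eq_start_iff.2 ⟨⟨by omega, hqk.1⟩, hqk.2.1⟩, southMark_eq_start_iff] at hmark
  exact Prod.ext (by omega) (by omega)

theorem determined_down (hq : q ∈ square P.n) (hkind : P.kind q = .down)
    (hnorth : P.Fits q p .north) : p ∈ square P.n ∧ P.labeling.label p = P.labeling.label q := by
  obtain ⟨hmem, hmark, hrow⟩ := fits_north_iff.1 hnorth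
  have hqk := kind_eq_down_iff.1 hkind
  have htop := P.add_one_ne_of_dvd hq hqk.2.1 hqk.2.2
  rw [mem_square] at hq hmem ⊢
  rw [southMark_eq_down_iff.2 ⟨⟨by omega, by omega⟩, hqk.2⟩, southMark_eq_down_iff] at hmark
  obtain ⟨x, y⟩ := p
  obtain ⟨x', y'⟩ := q
  obtain rfl : y = y' := by simp only at *; omega
  simp only at *
  refine ⟨by omega, label_eq_of_placeValue_dvd ⟨by omega, by omega⟩ ⟨by omega, by omega⟩
    hq.2.1 hqk.1 ?_⟩
  simpa using dvd_sub hqk.2.2 hmark.2.2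

theorem determined_strong (hq : q ∈ square P.n) (hkind : P.kind q = .strong)
    (hwest : P.Fits q p .west) : p ∈ square P.n ∧ P.labeling.label p = P.labeling.label q := by
  obtain ⟨hmem, hmark, hrow⟩ := fits_west_iff.1 hwest
  have hqk := kind_eq_strong_iff.1 hkind
  rw [mem_square] at hq hmem ⊢
  rw [westMark_eq_strong_iff.2 ⟨hqk.1, by omega, hqk.2.2.1, hqk.2.2.2⟩,
    westMark_eq_strong_iff] at hmark
  obtain ⟨x, y⟩ := p
  obtain ⟨x', y'⟩ := q
  obtain rfl : y = y' := by simp only at *; omega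
  simp only at *
  have hx : x ≠ P.n := by
    rintro rfl
    simp at hmark
  refine ⟨by omega, label_eq_of_placeValue_dvd ⟨by omega, by omega⟩ ⟨by omega, by omega⟩
    hq.2.1 hqk.1 ?_⟩
  simpa using placeValue_add_one_dvd_sub_of_not_dvd hq.2.1 hqk.2.2.1 hqk.2.2.2
    hmark.2.2.1 hmark.2.2.2

theorem determined_digit (hq : q ∈ square P.n) (hkind : P.kind q = .digit)
    (hsouth : P.Fits q p .south) (hwest : P.Fits q p .west) :
    p ∈ square P.n ∧ P.labeling.label p = P.labeling.label q := by
  obtain ⟨hmem, hsmark, hrow⟩ := fits_south_iff.1 hsouth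
  obtain ⟨-, hwmark, -⟩ := fits_west_iff.1 hwest
  have hqk := kind_eq_digit_iff.1 hkind
  have hqy : q.2 ≠ 0 := fun h => hqk.2.2.1 (by simp [h, placeValue_zero])
  rw [mem_square] at hq hmem ⊢
  obtain ⟨x, y⟩ := p
  obtain ⟨x', y'⟩ := q
  obtain rfl : y = y' := by simp only at *; omega
  simp only at *
  have hs := southMark_eq_agree_iff.1 (hsmark.trans (southMark_eq_agree_iff.2
    ⟨⟨by omega, hqk.1⟩, ⟨hqk.2.1, hqk.2.2.1⟩, fun t => rfl⟩))
  have hw := westMark_eq_digit_iff.1 (hwmark.trans (westMark_eq_digit_iff.2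
    ⟨hqk.1, by omega, hqk.2.2.1, hqk.2.2.2, rfl⟩))
  have hdvd (t : Target) : placeValue y ∣ P.target t - x ↔ placeValue y ∣ P.target t - x' :=
    (decide_eq_decide.1 (hs.2.2 t)).symm
  have hbit : bit y (P.n - x) = bit y (P.n - x') := hw.2.2.2.2.symm
  have hdvd' (t : Target) :
      placeValue (y + 1) ∣ P.target t - x ↔ placeValue (y + 1) ∣ P.target t - x' := by
    have h (c : ℤ) : P.target t - c = P.n - c - (P.n - P.target t) := by ring
    rw [h x, h x', placeValue_add_one_dvd_sub_iff hq.2.1, placeValue_add_one_dvd_sub_iff hq.2.1,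
      ← h x, ← h x', hdvd, hbit]
  refine ⟨by omega, label_ext rfl ?_ ?_ hsmark hwmark⟩
  · exact southMark_congr ⟨by omega, by omega⟩ ⟨by omega, by omega⟩ (by simp only; omega)
      (iff_of_false hw.2.2.2.1 hqk.2.2.2) hdvd'
  · -- The digits of `n - (x + 1)` in the rows below `y` vanish if `x` agrees there with `n - 1`.
    refine westMark_congr (by simp only; omega) (by simp only; omega) hq.2.1 hqk.1 ?_ ?_
    · simpa only [target, sub_sub, add_comm (1 : ℤ)] using hdvd .last
    · rw [← sub_sub, ← sub_sub, bit_sub_one hw.2.2.1, bit_sub_one hqk.2.2.1, hbit]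

theorem determined_diagonal (hq : q ∈ square P.n) (hkind : P.kind q = .diagonal)
    (hsouth : P.Fits q p .south) :
    p ∈ square P.n ∧ P.labeling.label p = P.labeling.label q := by
  obtain ⟨hmem, hmark, -⟩ := fits_south_iff.1 hsouth
  have hqk := kind_eq_diagonal_iff.1 hkind
  rw [southMark_of_le hqk.1, southMark_eq_up_iff] at hmark
  simp only [decide_eq_decide] at hmark
  rw [mem_square] at *
  exact ⟨by omega, label_eq_of_le hmark.1 hqk.1 (by omega) (by omega) (by omega) (by omega)
    (by omega) (by omega)⟩

theorem determined_right (hq : q ∈ square P.n) (hkind : P.kind q = .right)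
    (hsouth : P.Fits q p .south) (hwest : P.Fits q p .west) :
    p ∈ square P.n ∧ P.labeling.label p = P.labeling.label q := by
  obtain ⟨hsmem, hsmark, -⟩ := fits_south_iff.1 hsouth
  obtain ⟨hwmem, hwmark, -⟩ := fits_west_iff.1 hwest
  have hqk := kind_eq_right_iff.1 hkind
  rw [southMark_of_le hqk.1, southMark_eq_up_iff] at hsmark
  rw [westMark_eq_east_iff.2 ⟨hqk.1, hqk.2, rfl, rfl⟩, westMark_eq_east_iff] at hwmark
  simp only [decide_eq_decide] at hsmark hwmark
  rw [mem_square] at *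
  exact ⟨by omega, label_eq_of_le hsmark.1 hqk.1 (by omega) (by omega) (by omega) (by omega)
    (by omega) (by omega)⟩

theorem determined_left (hq : q ∈ square P.n) (hkind : P.kind q = .left)
    (hsouth : P.Fits q p .south) (heast : P.Fits q p .east) :
    p ∈ square P.n ∧ P.labeling.label p = P.labeling.label q := by
  obtain ⟨hsmem, hsmark, -⟩ := fits_south_iff.1 hsouth
  obtain ⟨hemem, hemark, -⟩ := fits_east_iff.1 heast
  have hqk := kind_eq_left_iff.1 hkind
  rw [southMark_of_le hqk.1, southMark_eq_up_iff] at hsmark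
  rw [westMark_eq_west_iff.2 ⟨hqk.1, hqk.2, rfl⟩, westMark_eq_west_iff] at hemark
  simp only [decide_eq_decide] at hsmark hemark
  rw [mem_square] at *
  exact ⟨by omega, label_eq_of_le hsmark.1 hqk.1 (by omega) (by omega) (by omega) (by omega)
    (by omega) (by omega)⟩

end Determined

/-- The order of assembly. The counter grows column by column, and each column of the counter
grows downwards as long as the digits are `0` and upwards from the lowest digit `1`; the rows of
the body grow one by one, starting at the diagonal. -/
def rank (P : Layout) (p : Pos) : ℤ ×ₗ ℤ ×ₗ ℤ :=
  if p.2 < P.k then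
    toLex (0, toLex (p.1, if p.1 ≠ 0 ∧ placeValue p.2 ∣ P.n - p.1 then -p.2 else p.2))
  else toLex (1, toLex (p.2, ((p.1 - p.2).natAbs : ℤ)))

theorem rank_lt_of_fst_lt {x y x' y' : ℤ} (hy : y < P.k) (hy' : y' < P.k) (h : x < x') :
    P.rank (x, y) < P.rank (x', y') := by
  simp [rank, hy, hy', Prod.Lex.toLex_lt_toLex, h]

theorem rank_lt_of_snd_lt {x y x' y' : ℤ} (hy : P.k ≤ y) (h : y' < y) :
    P.rank (x', y') < P.rank (x, y) := by
  unfold rank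
  split_ifs <;> simp [Prod.Lex.toLex_lt_toLex] <;> omega

theorem rank_lt_of_natAbs {x y x' : ℤ} (hy : P.k ≤ y) (h : (x' - y).natAbs < (x - y).natAbs) :
    P.rank (x', y) < P.rank (x, y) := by
  rw [rank, rank, if_neg hy.not_gt, if_neg hy.not_gt]
  simpa only [Prod.Lex.toLex_lt_toLex, lt_self_iff_false, false_or, true_and, Nat.cast_lt] using h

theorem rank_sub_one_lt {x y : ℤ} (hy : 0 < y) (hyk : y < P.k)
    (h : x = 0 ∨ ¬ placeValue y ∣ P.n - x) : P.rank (x, y - 1) < P.rank (x, y) := by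
  have hx : ¬ (x ≠ 0 ∧ placeValue y ∣ P.n - x) := by tauto
  rw [rank, rank, if_pos hyk, if_pos (show y - 1 < P.k by omega), if_neg hx]
  split_ifs <;> simp [Prod.Lex.toLex_lt_toLex]
  omega

theorem rank_add_one_lt {x y : ℤ} (hy : 0 ≤ y) (hyk : y + 1 < P.k) (hx : x ≠ 0)
    (h : placeValue (y + 1) ∣ P.n - x) : P.rank (x, y + 1) < P.rank (x, y) := by
  have h' := placeValue_dvd_of_add_one_dvd hy h
  simp [rank, hyk, show y < P.k by omega, hx, h, h', Prod.Lex.toLex_lt_toLex]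

theorem input_mem_of_lt_k (hp : p ∈ square P.n) (hpk : p.2 < P.k) (d : Dir)
    (hd : 0 < (P.kind p).input d) :
    p + d.vec ∈ square P.n ∧ P.rank (p + d.vec) < P.rank p := by
  obtain ⟨x, y⟩ := p
  have htop := P.add_one_ne_of_dvd hp
  have hkn := P.k_le
  rw [mem_square] at *
  rcases hκ : P.kind (x, y)
  case diagonal => exact absurd (kind_eq_diagonal_iff.1 hκ).1 hpk.not_ge
  case right => exact absurd (kind_eq_right_iff.1 hκ).1 hpk.not_ge
  case left => exact absurd (kind_eq_left_iff.1 hκ).1 hpk.not_ge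
  all_goals
    cases d <;> simp only [hκ, Kind.input, lt_self_iff_false] at hd <;>
      simp only [Dir.vec, Prod.mk_add_mk, add_zero, ← sub_eq_add_neg] at *
  case start.south =>
    obtain ⟨-, hx : x = 0, hy : y ≠ 0⟩ := kind_eq_start_iff.1 hκ
    exact ⟨by omega, rank_sub_one_lt (by omega) hpk (.inl hx)⟩
  case down.north =>
    obtain ⟨-, hx, hdvd⟩ := kind_eq_down_iff.1 hκ
    have := htop hx hdvd
    exact ⟨by omega, rank_add_one_lt hp.2.1 (by omega) hx hdvd⟩
  case strong.west =>
    obtain ⟨-, hx : x ≠ 0, -⟩ := kind_eq_strong_iff.1 hκ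
    exact ⟨by omega, rank_lt_of_fst_lt hpk hpk (sub_one_lt x)⟩
  case digit.south =>
    obtain ⟨-, -, hdvd : ¬ placeValue y ∣ P.n - x, -⟩ := kind_eq_digit_iff.1 hκ
    have hy : y ≠ 0 := fun h => hdvd (by simp [h, placeValue_zero])
    exact ⟨by omega, rank_sub_one_lt (by omega) hpk (.inr hdvd)⟩
  case digit.west =>
    obtain ⟨-, hx : x ≠ 0, -⟩ := kind_eq_digit_iff.1 hκ
    exact ⟨by omega, rank_lt_of_fst_lt hpk hpk (sub_one_lt x)⟩

theorem input_mem_of_k_le (hp : p ∈ square P.n) (hpk : P.k ≤ p.2) (d : Dir)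
    (hd : 0 < (P.kind p).input d) :
    p + d.vec ∈ square P.n ∧ P.rank (p + d.vec) < P.rank p := by
  obtain ⟨x, y⟩ := p
  have hk := P.k_pos
  rw [mem_square] at *
  rcases lt_trichotomy x y with hx | hx | hx
  case' inl => rw [kind_eq_left_iff.2 ⟨hpk, hx⟩] at hd
  case' inr.inl => rw [kind_eq_diagonal_iff.2 ⟨hpk, hx⟩] at hd
  case' inr.inr => rw [kind_eq_right_iff.2 ⟨hpk, hx⟩] at hd
  all_goals
    cases d <;> simp only [Kind.input, lt_self_iff_false] at hd <;>
      simp only [Dir.vec, Prod.mk_add_mk, add_zero, ← sub_eq_add_neg] at *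
  case inl.east => exact ⟨by omega, rank_lt_of_natAbs hpk (by omega)⟩
  case inr.inr.west => exact ⟨by omega, rank_lt_of_natAbs hpk (by omega)⟩
  all_goals exact ⟨by omega, rank_lt_of_snd_lt hpk (sub_one_lt y)⟩

theorem input_mem (hp : p ∈ square P.n) (d : Dir) (hd : 0 < P.labeling.input p d) :
    p + d.vec ∈ square P.n ∧ P.rank (p + d.vec) < P.rank p := by
  rw [input_eq hp] at hd
  rcases lt_or_ge p.2 P.k with hpk | hpk
  · exact input_mem_of_lt_k hp hpk d hd
  · exact input_mem_of_k_le hp hpk d hd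

theorem flow_axis (p : Pos) (d : Dir) (hd : 0 < (P.labeling.label p d).1.strength) :
    (P.labeling.label p d).1.flow = d ∨ (P.labeling.label p d).1.flow = d.opp := by
  revert hd
  cases d <;> simp only [labeling, southMark, westMark] <;> split_ifs <;>
    simp [Mark.strength, Mark.flow, Dir.opp]

theorem zero_mem_square : (0 : Pos) ∈ square P.n := by
  have := P.k_pos
  have := P.k_le
  simp only [mem_square, Prod.fst_zero, Prod.snd_zero]
  omega

theorem determined (hq : q ∈ square P.n) (hne : q ≠ 0)
    (h : ∀ d, 0 < P.labeling.input q d → P.Fits q p d) :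
    p ∈ square P.n ∧ P.labeling.label p = P.labeling.label q := by
  have hfits (d : Dir) (hd : 0 < (P.kind q).input d) : P.Fits q p d :=
    h d (by rwa [input_eq hq])
  rcases hκ : P.kind q <;> rw [hκ] at hfits
  case seed => exact absurd (Prod.ext_iff.2 (kind_eq_seed_iff.1 hκ).2) hne
  case start =>
    obtain rfl := determined_start hq hκ (hfits .south two_pos)
    exact ⟨hq, rfl⟩
  case down => exact determined_down hq hκ (hfits .north two_pos)
  case strong => exact determined_strong hq hκ (hfits .west two_pos)
  case digit => exact determined_digit hq hκ (hfits .south one_pos) (hfits .west one_pos)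
  case diagonal => exact determined_diagonal hq hκ (hfits .south two_pos)
  case right => exact determined_right hq hκ (hfits .south one_pos) (hfits .west one_pos)
  case left => exact determined_left hq hκ (hfits .south one_pos) (hfits .east one_pos)

/-- The blueprint that assembles the square with the marks of a layout. -/
noncomputable def blueprint (P : Layout) : Blueprint (Mark × ℤ) (ℤ ×ₗ ℤ ×ₗ ℤ) where
  toLabeling := P.labeling
  cells := square P.n
  seed := 0
  rank := P.rank
  seed_mem := zero_mem_square
  flow_axis p _ d hd := flow_axis p d hd
  input_seed d := by
    rw [input_eq zero_mem_square, kind_eq_seed_iff.2 ⟨P.k_pos, rfl, rfl⟩]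
    rfl
  sum_input p hp hne := by
    simp only [input_eq hp]
    rcases hκ : P.kind p
    case seed => exact absurd (Prod.ext_iff.2 (kind_eq_seed_iff.1 hκ).2) hne
    all_goals rfl
  input_mem _ hp d hd := input_mem hp d hd
  determined _ hq hne _ h := determined hq hne h

variable {A : Type*} (a : A)

theorem tileUnique_pixel (hj : P.k ≤ P.j) : P.blueprint.TileUnique a (P.i, P.j) := by
  intro p _ htile
  have hsouth := congrArg Prod.fst (Blueprint.tile_apply_eq (d := .south) htile (by
    change 0 < (P.southMark P.i P.j).strength
    rw [southMark_of_le hj]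
    cases decide (P.i = P.j) <;> simp [Mark.strength]))
  change P.southMark p.1 p.2 = P.southMark P.i P.j at hsouth
  rw [southMark_of_le hj, southMark_eq_up_iff] at hsouth
  obtain ⟨-, hdiag, hi, -⟩ := hsouth
  replace hdiag : P.i = P.j ↔ p.1 = p.2 := decide_eq_decide.1 hdiag
  replace hi : p.1 = P.i := of_decide_eq_true (hi.symm.trans (decide_eq_true rfl))
  refine Prod.ext hi ?_
  rcases lt_trichotomy P.i P.j with hlt | heq | hlt
  · have hmark : P.westMark (P.i + 1) P.j = .west true :=
      westMark_eq_west_iff.2 ⟨hj, by omega, by simp⟩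
    have heast := congrArg Prod.fst (Blueprint.tile_apply_eq (d := .east) htile (by
      change 0 < (P.westMark (P.i + 1) P.j).strength
      rw [hmark]
      exact one_pos))
    exact of_decide_eq_true (westMark_eq_west_iff.1 (heast.trans hmark)).2.2.symm
  · exact (hdiag.1 heq).symm.trans (hi.trans heq)
  · have hmark : P.westMark P.i P.j = .east (P.i = P.j + 1) true :=
      westMark_eq_east_iff.2 ⟨hj, hlt, rfl, by simp⟩
    have hwest := congrArg Prod.fst (Blueprint.tile_apply_eq (d := .west) htile (by
      change 0 < (P.westMark P.i P.j).strength
      rw [hmark]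
      exact one_pos))
    exact of_decide_eq_true (westMark_eq_east_iff.1 (hwest.trans hmark)).2.2.2.symm

/-- The labels of a location with the marks `m` and the shared row number `r`. -/
def rowLabel (P : Layout) (m : Dir → Mark) (r : ℤ) (d : Dir) : Mark × ℤ :=
  (m d, if d = .north then min (r + 1) P.k else r)

theorem label_eq_rowLabel (p : Pos) :
    P.labeling.label p = P.rowLabel (fun d => (P.labeling.label p d).1) (min p.2 P.k) := by
  funext d
  cases d <;> simp [labeling, rowLabel]
  omega

theorem card_tiles_blueprint_le :
    (P.blueprint.system a).tiles.card ≤ (P.k + 1).toNat * Fintype.card (Dir → Mark) := by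
  classical
  have hsub : (P.blueprint.system a).tiles ⊆ (Finset.Icc 0 P.k ×ˢ Finset.univ).image
      fun rm : ℤ × (Dir → Mark) => fun d => P.blueprint.glue a (P.rowLabel rm.2 rm.1 d) := by
    intro t ht
    obtain ⟨p, hp, rfl⟩ := Blueprint.mem_tiles.1 ht
    have hmin : min p.2 P.k ∈ Finset.Icc 0 P.k :=
      Finset.mem_Icc.2 ⟨le_min (mem_square.1 hp).2.1 P.k_pos.le, min_le_right _ _⟩
    refine Finset.mem_image.2 ⟨(min p.2 P.k, fun d => (P.labeling.label p d).1),
      Finset.mk_mem_product hmin (Finset.mem_univ _), ?_⟩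
    funext d
    exact congrArg (P.blueprint.glue a) (congrFun (label_eq_rowLabel p) d).symm
  refine (Finset.card_le_card hsub).trans (Finset.card_image_le.trans_eq ?_)
  rw [Finset.card_product, Int.card_Icc, sub_zero, Finset.card_univ]

theorem card_tiles_discrete_le :
    (P.blueprint.discrete.system a).tiles.card ≤ P.n.toNat * P.n.toNat := by
  classical
  refine Finset.card_image_le.trans_eq ?_
  change (square P.n).card = _
  rw [square, Finset.card_product, Int.card_Ico, sub_zero]

end Layout

/-! ### The number of tile types -/

section Growth

open Asymptotics Filter

theorem two_mul_clog_two_le {n : ℕ} (hn : 6 ≤ n) : 2 * Nat.clog 2 n ≤ n := by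
  have hpow : ∀ m, 3 ≤ m → 2 * m + 1 ≤ 2 ^ m := fun m hm => by
    induction m, hm using Nat.le_induction with
    | base => decide
    | succ m _ ih => omega
  have hle : Nat.clog 2 n ≤ n / 2 := Nat.clog_le_of_le_pow (by have := hpow (n / 2); omega)
  omega

theorem isBigO_const_log (c : ℝ) :
    (fun _ : ℕ => c) =O[atTop] fun n : ℕ => Real.log n :=
  (isLittleO_const_left.2 (.inr (tendsto_norm_atTop_atTop.comp
    (Real.tendsto_log_atTop.comp tendsto_natCast_atTop_atTop)))).isBigO

theorem isBigO_clog_log (b : ℕ) :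
    (fun n : ℕ => (Nat.clog b n : ℝ)) =O[atTop] fun n : ℕ => Real.log n := by
  have hle (n : ℕ) : (Nat.clog b n : ℝ) ≤ Real.logb b n + 1 := by
    rw [← Real.natCeil_logb_natCast]
    have hlogb : 0 ≤ Real.logb b n :=
      div_nonneg (Real.log_natCast_nonneg n) (Real.log_natCast_nonneg b)
    exact (Nat.ceil_lt_add_one hlogb).le
  refine (IsBigO.of_bound 1 (.of_forall fun n => ?_)).trans
    (IsBigO.add (f₁ := fun n : ℕ => Real.logb b n) ?_ (isBigO_const_log 1))
  · rw [one_mul, RCLike.norm_natCast]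
    exact (hle n).trans (le_abs_self _)
  · simp only [Real.logb, div_eq_inv_mul]
    exact (isBigO_refl _ _).const_mul_left _

end Growth

section Bounds

variable {A : Type*} [Nonempty A] {n i j : ℕ}

/-- The layout of the `n × n` square with pixel `(i, j)` and `k` counter rows. -/
def Layout.ofNat (n k i j : ℕ) (hk : 0 < k) (hkn : k ≤ n) (hn : n ≤ 2 ^ k) (hi : i < n)
    (hj : j < n) : Layout where
  n := n
  k := k
  i := i
  j := j
  k_pos := by exact_mod_cast hk
  k_le := by exact_mod_cast hkn
  n_le := by
    rw [placeValue, Int.toNat_natCast]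
    exact_mod_cast hn
  i_mem := ⟨by positivity, by exact_mod_cast hi⟩
  j_mem := ⟨by positivity, by exact_mod_cast hj⟩

theorem hasSinglePixelSystem_sq (hi : i < n) (hj : j < n) :
    HasSinglePixelSystem A n i j (n * n) := by
  let a := Classical.arbitrary A
  let P := Layout.ofNat n n i j (by omega) le_rfl Nat.lt_two_pow_self.le hi hj
  refine P.blueprint.discrete.hasSinglePixelSystem (a := a) rfl (fun p hp h => ?_)
    (P.card_tiles_discrete_le a)
  exact P.blueprint.tile_discrete_injOn a hp (mem_square.2 ⟨P.i_mem, P.j_mem⟩) h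

theorem hasSinglePixelSystem_of_le_two_pow {k : ℕ} (hk : 0 < k) (hkn : 2 * k ≤ n)
    (hn : n ≤ 2 ^ k) (hi : i < n) (hj : j < n) :
    HasSinglePixelSystem A n i j ((k + 1) * Fintype.card (Dir → Mark)) := by
  let a := Classical.arbitrary A
  rcases le_or_gt k j with hkj | hkj
  · let P := Layout.ofNat n k i j hk (by omega) hn hi hj
    exact P.blueprint.hasSinglePixelSystem rfl (P.tileUnique_pixel a (Int.ofNat_le.2 hkj))
      (P.card_tiles_blueprint_le a)
  · let P := Layout.ofNat n k i (n - 1 - j) hk (by omega) hn hi (by omega)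
    exact P.blueprint.hasSinglePixelSystem_reflection rfl hj
      (P.tileUnique_pixel a (Int.ofNat_le.2 (by omega))) (P.card_tiles_blueprint_le a)

theorem hasSinglePixelSystem_clog (hi : i < n) (hj : j < n) :
    HasSinglePixelSystem A n i j ((Nat.clog 2 n + 1) * Fintype.card (Dir → Mark) + 25) := by
  rcases le_or_gt 6 n with hn | hn
  · exact (hasSinglePixelSystem_of_le_two_pow (Nat.clog_pos one_lt_two (by omega))
      (two_mul_clog_two_le hn) (Nat.le_pow_clog one_lt_two n) hi hj).mono (Nat.le_add_right _ _)
  · exact (hasSinglePixelSystem_sq hi hj).mono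
      ((Nat.mul_le_mul (by omega : n ≤ 5) (by omega : n ≤ 5)).trans (Nat.le_add_left _ _))

end Bounds

end ATAM

theorem theorem1 (A : Type*) [Nonempty A] :
    ∃ f : ℕ → ℝ, Asymptotics.IsBigO Filter.atTop f (fun n : ℕ => Real.log n) ∧
      ∀ n i j : ℕ, i < n → j < n →
        ∃ (𝒯 : ATAM.TAS A) (color : ATAM.TileType A → ATAM.Color),
          𝒯.temp = 2 ∧ 𝒯.seed.dom.ncard = 1 ∧ (𝒯.tiles.card : ℝ) ≤ f n ∧
          𝒯.WeaklySelfAssembles color Set.univ (ATAM.singlePixel n i j) := by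
  let m (n : ℕ) : ℕ := (Nat.clog 2 n + 1) * Fintype.card (ATAM.Dir → ATAM.Mark) + 25
  refine ⟨fun n => m n, ?_, fun n i j hi hj => ?_⟩
  · simp only [m, Nat.cast_add, Nat.cast_mul, mul_comm _ (Fintype.card _ : ℝ)]
    exact ((((ATAM.isBigO_clog_log 2).add (ATAM.isBigO_const_log _)).const_mul_left _)).add
      (ATAM.isBigO_const_log _)
  · obtain ⟨𝒯, color, htemp, hseed, hcard, hassembles⟩ :=
      ATAM.hasSinglePixelSystem_clog (A := A) hi hj
    exact ⟨𝒯, color, htemp, hseed, Nat.cast_le.2 hcard, hassembles⟩
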